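/- Notation. For an integer $n\ge 0$ let $\varepsilon_j(n)\in\{0,1\}$ be its binary digits, $n=\sum_{j\ge 0}\varepsilon_j(n)2^j$; let $\mathrm{Sp}(n)=\{j:\varepsilon_j(n)=1\}$ be its spectrum and $V(n)=\varepsilon_0(n)+\sum_{j\ge 1}|\varepsilon_j(n)-\varepsilon_{j-1}(n)|$ its variation. Let $r$ be the $1$-periodic function with $r=1$ on $[0,1/2)$ and $r=-1$ on $[1/2,1)$, let $w_n(x)=\prod_{j\ge 0} r(2^jx)^{\varepsilon_j(n)}$ be the Walsh functions, and for $f\in L[0,1)$ let $S_m(f)=\sum_{k=0}^{m-1}\widehat f(k)\,w_k$ with $\widehat f(k)=\int_{[0,1)}f\,w_k$. Let $\Phi$ be the set of non-decreasing $\varphi:[0,\infty)\to[0,\infty)$ with $\liminf_{u\to\infty}\varphi(u)/u>0$; $\varphi(L)[0,1)$ is the class of measurable $f:[0,1)\to\mathbb R$ with $\int_{[0,1)}\varphi(|f|)<\infty$ (for $\varphi\in\Phi$ such $f$ are integrable). A strictly increasing sequence $(n_k)_{k\ge 1}$ of positive integers has nested spectra if $\mathrm{Sp}(n_{k+1})\cap[0,\max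 \mathrm{Sp}(n_k)]=\mathrm{Sp}(n_k)$ for every $k$, and unbounded variation if $\sup_k V(n_k)=\infty$. For such a sequence let $\varphi_{(n_k)}:[0,\infty)\to[0,\infty)$ be the function with $\varphi_{(n_k)}(0)=0$ and $\varphi_{(n_k)}(2^{2n_\nu})=2^{2n_\nu}V(n_\nu)$ for every $\nu\ge 1$ that is linear on $[0,2^{2n_1}]$ and on each $[2^{2n_\nu},2^{2n_{\nu+1}}]$. Below, $\log=\log_2$. Theorem. (a) Let $(n_k)_{k\ge1}$ be a strictly increasing sequence of positive integers with nested spectra and unbounded variation. Then for every $\varphi\in\Phi$ with $\varphi(u)=o(\varphi_{(n_k)}(u))$ as $u\to\infty$ there exists $f\in\varphi(L)[0,1)$ such that $\sup_k|S_{n_k}(f)(x)|=\infty$ for every $x\in[0,1)$. (b) Let $n_k=\sum_{j=0}^k 4^j$ ($k\ge 1$). Then there are constants $c,C>0$ with $c\,u\log\log u\le\varphi_{(n_k)}(u)\le C\,u\log\log u$ for all $u\ge 8$; the sequence $(n_k)$ is lacunary, i.e. there is $q>1$ with $n_{k+1}/n_k\ge q$ for all $k$; and for every $\varphi\in\Phi$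 with $\varphi(u)=o(u\log\log u)$ as $u\to\infty$ there exists $f\in\varphi(L)[0,1)$ such that $\sup_k|S_{n_k}(f)(x)|=\infty$ for every $x\in[0,1)$. -/

import Mathlib

open scoped NNReal ENNReal

namespace WalshFourier

noncomputable section

/-- The binary coefficient `ε_j(n) ∈ {0, 1}`, so that `n = ∑ j, ε_j(n) 2 ^ j`. -/
def binCoeff (j n : ℕ) : ℕ := if n.testBit j then 1 else 0

/-- The spectrum `Sp(n) = {j : ε_j(n) = 1}` of a natural number.
Since `n < 2 ^ j` for `j ≥ n`, only the indices `j < n` can occur. -/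
def binSpectrum (n : ℕ) : Finset ℕ := (Finset.range n).filter fun j => binCoeff j n = 1

/-- The binary variation `V(n) = ε_0(n) + ∑_{j ≥ 1} |ε_j(n) - ε_{j-1}(n)|`.
The terms with `j > n` all vanish. -/
def binVariation (n : ℕ) : ℕ :=
  binCoeff 0 n + ∑ j ∈ Finset.Icc 1 n, ((binCoeff j n : ℤ) - (binCoeff (j - 1) n : ℤ)).natAbs

/-- `Sp(n_{k+1}) ∩ [0, max Sp(n_k)] = Sp(n_k)` for every `k`
(used for sequences of positive integers, whose spectra are nonempty). -/
def HasNestedSpectra (n : ℕ → ℕ) : Prop :=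
  ∀ k, binSpectrum (n (k + 1)) ∩ Finset.Iic ((binSpectrum (n k)).sup id) = binSpectrum (n k)

/-- `sup_k V(n_k) = ∞`. -/
def HasUnboundedVariation (n : ℕ → ℕ) : Prop :=
  ¬ BddAbove (Set.range fun k => binVariation (n k))

/-- A sequence `(n_k)` of positive integers is lacunary if `n_{k+1} / n_k ≥ q` for all `k` and
some `q > 1`. -/
def IsLacunary (n : ℕ → ℕ) : Prop :=
  ∃ q : ℝ, 1 < q ∧ ∀ k, q ≤ (n (k + 1) : ℝ) / (n k : ℝ)

/-- The `1`-periodic function equal to `1` on `[0, 1/2)` and to `-1` on `[1/2, 1)`. -/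
def rademacherBase (x : ℝ) : ℝ := if Int.fract x < 1 / 2 then 1 else -1

/-- The Rademacher functions `r_j(x) = r(2 ^ j x)`. -/
def rademacher (j : ℕ) (x : ℝ) : ℝ := rademacherBase ((2 : ℝ) ^ j * x)

/-- The Walsh functions `w_n(x) = ∏_j r_j(x) ^ ε_j(n)` (Paley ordering).
The factors with `j ≥ n` are all equal to `1`. -/
def walsh (n : ℕ) (x : ℝ) : ℝ := ∏ j ∈ Finset.range n, rademacher j x ^ binCoeff j n

/-- The Walsh–Fourier coefficients over `[0, 1)`. -/
def walshCoeff (f : ℝ → ℝ) (k : ℕ) : ℝ := ∫ x in Set.Ico (0 : ℝ) 1, f x * walsh k x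

/-- The partial sums `S_m(f) = ∑_{k < m} f̂(k) w_k`. -/
def walshSum (f : ℝ → ℝ) (m : ℕ) (x : ℝ) : ℝ :=
  ∑ k ∈ Finset.range m, walshCoeff f k * walsh k x

/-- The nodes `2 ^ (2 n_ν)` of the function `φ_{(n_k)}`. -/
def phiNode (n : ℕ → ℕ) (ν : ℕ) : ℝ := (2 : ℝ) ^ (2 * n ν)

/-- The values `2 ^ (2 n_ν) V(n_ν)` of `φ_{(n_k)}` at its nodes. -/
def phiValue (n : ℕ → ℕ) (ν : ℕ) : ℝ := phiNode n ν * (binVariation (n ν) : ℝ)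

/-- The function `φ_{(n_k)}` on `[0, ∞)`: it is linear on the segment from `0` to the first node,
with value `0` at `0`, and is the linear interpolation between consecutive nodes.
For `u` at or beyond the first node, the index `ν` below is the one of the last node `≤ u`. -/
def phiSeq (n : ℕ → ℕ) (u : ℝ) : ℝ :=
  if u < phiNode n 0 then
    phiValue n 0 * (u / phiNode n 0)
  else
    let ν := sSup {i : ℕ | phiNode n i ≤ u}
    phiValue n ν + (phiValue n (ν + 1) - phiValue n ν) *
      ((u - phiNode n ν) / (phiNode n (ν + 1) - phiNode n ν))

/-- The class `Φ` of non-decreasing `φ : [0, ∞) → [0, ∞)` with `liminf_{u → ∞} φ(u) / u > 0`. -/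
def IsPhiClass (φ : ℝ≥0 → ℝ≥0) : Prop :=
  Monotone φ ∧ 0 < Filter.liminf (fun u : ℝ≥0 => (φ u : ℝ≥0∞) / (u : ℝ≥0∞)) Filter.atTop

/-- The class `φ(L)(E)` of the (Lebesgue) measurable functions on `E` with `∫_E φ(|f|) < ∞`. -/
def MemPhiL (φ : ℝ≥0 → ℝ≥0) (E : Set ℝ) (f : ℝ → ℝ) : Prop :=
  AEMeasurable f (MeasureTheory.volume.restrict E) ∧ ∫⁻ x in E, (φ ‖f x‖₊ : ℝ≥0∞) < ∞

/-- The sequence `n_k = ∑_{j=0}^{k} 4 ^ j`, `k = 1, 2, …`, indexed here from `0`. -/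
def fourSeq (k : ℕ) : ℕ := ∑ j ∈ Finset.range (k + 2), 4 ^ j

end

end WalshFourier

namespace WalshFourier

open MeasureTheory

/-! ### Basic properties of the Walsh system -/

lemma rademacherBase_sq (x : ℝ) : rademacherBase x * rademacherBase x = 1 := by
  unfold rademacherBase; split_ifs <;> norm_num

lemma rademacher_sq (j : ℕ) (x : ℝ) : rademacher j x * rademacher j x = 1 :=
  rademacherBase_sq _

lemma rademacher_eq_or (j : ℕ) (x : ℝ) : rademacher j x = 1 ∨ rademacher j x = -1 :=
  mul_self_eq_one_iff.1 (rademacher_sq j x)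

lemma measurable_rademacher (j : ℕ) : Measurable (rademacher j) := by
  unfold rademacher rademacherBase
  refine Measurable.ite ?_ measurable_const measurable_const
  exact measurableSet_lt (measurable_fract.comp (measurable_const.mul measurable_id))
    measurable_const

lemma binCoeff_eq_zero {j n : ℕ} (h : n ≤ j) : binCoeff j n = 0 := by
  have : n.testBit j = false := Nat.testBit_lt_two_pow (h.trans_lt Nat.lt_two_pow_self)
  simp [binCoeff, this]

lemma walsh_eq_prod {n N : ℕ} (h : n ≤ N) (x : ℝ) :
    walsh n x = ∏ j ∈ Finset.range N, rademacher j x ^ binCoeff j n := by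
  unfold walsh
  refine Finset.prod_subset (Finset.range_mono h) fun j _ hj => ?_
  rw [binCoeff_eq_zero (by simpa using hj), pow_zero]

lemma walsh_zero : walsh 0 = 1 := by ext x; simp [walsh]

lemma walsh_xor (k l : ℕ) : walsh (k ^^^ l) = walsh k * walsh l := by
  ext x
  set N := max (k ^^^ l) (max k l)
  rw [Pi.mul_apply, walsh_eq_prod (N := N) (by simp [N]), walsh_eq_prod (n := k) (N := N) (by simp [N]),
    walsh_eq_prod (n := l) (N := N) (by simp [N]), ← Finset.prod_mul_distrib]
  refine Finset.prod_congr rfl fun j _ => ?_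
  have := rademacher_sq j x
  unfold binCoeff
  rw [Nat.testBit_xor]
  cases k.testBit j <;> cases l.testBit j <;> simp [this]

lemma walsh_mul_self (k : ℕ) (x : ℝ) : walsh k x * walsh k x = 1 := by
  have := congrFun (walsh_xor k k) x
  simpa [walsh_zero] using this.symm

lemma walsh_eq_or (k : ℕ) (x : ℝ) : walsh k x = 1 ∨ walsh k x = -1 :=
  mul_self_eq_one_iff.1 (walsh_mul_self k x)

lemma abs_walsh (k : ℕ) (x : ℝ) : |walsh k x| = 1 := by
  rcases walsh_eq_or k x with h | h <;> simp [h]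

lemma measurable_walsh (k : ℕ) : Measurable (walsh k) := by
  unfold walsh
  exact Finset.measurable_fun_prod _ fun j _ => (measurable_rademacher j).pow_const _

lemma walsh_two_pow (j : ℕ) : walsh (2 ^ j) = rademacher j := by
  ext x
  unfold walsh
  rw [Finset.prod_eq_single j]
  · simp [binCoeff]
  · intro i _ hij
    simp [binCoeff, Ne.symm hij]
  · intro h
    exact absurd Nat.lt_two_pow_self (by simpa using h)

lemma walsh_two_mul_add (k b : ℕ) (hb : b < 2) (x : ℝ) :
    walsh (2 * k + b) x = rademacherBase x ^ b * walsh k (2 * x) := by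
  rw [walsh_eq_prod (N := (2 * k + b) + 1) (by omega), Finset.prod_range_succ',
    walsh_eq_prod (n := k) (N := 2 * k + b) (by omega), mul_comm]
  congr 1
  · have : binCoeff 0 (2 * k + b) = b := by
      unfold binCoeff
      interval_cases b <;> simp [Nat.testBit_zero]
    rw [this]; simp [rademacher]
  · refine Finset.prod_congr rfl fun j _ => ?_
    have : binCoeff (j + 1) (2 * k + b) = binCoeff j k := by
      unfold binCoeff
      rw [Nat.testBit_succ, show (2 * k + b) / 2 = k by omega]
    rw [this, rademacher, rademacher, pow_succ, mul_assoc]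

lemma rademacherBase_add_int (x : ℝ) (m : ℤ) : rademacherBase (x + m) = rademacherBase x := by
  simp [rademacherBase]

lemma walsh_periodic (k : ℕ) : Function.Periodic (walsh k) 1 := by
  intro x
  unfold walsh
  refine Finset.prod_congr rfl fun j _ => ?_
  congr 1
  have := rademacherBase_add_int (2 ^ j * x) (2 ^ j)
  rw [rademacher, rademacher, ← this]
  push_cast
  ring_nf

lemma intervalIntegrable_walsh (k : ℕ) (a b : ℝ) :
    IntervalIntegrable (walsh k) volume a b := by
  rw [intervalIntegrable_iff]
  refine Measure.integrableOn_of_bounded (M := 1) (by simp) (measurable_walsh k).aestronglyMeasurable ?_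
  exact Filter.Eventually.of_forall fun x => by simp [abs_walsh]

lemma integral_walsh_half (k b : ℕ) (hb : b < 2) :
    ∫ x in (0 : ℝ)..1, walsh (2 * k + b) x =
      (1 + (-1) ^ b) / 2 * ∫ x in (0 : ℝ)..1, walsh k x := by
  rw [← intervalIntegral.integral_add_adjacent_intervals (b := 1 / 2)
    (intervalIntegrable_walsh _ _ _) (intervalIntegrable_walsh _ _ _)]
  have h1 : ∫ x in (0 : ℝ)..(1 / 2), walsh (2 * k + b) x =
      ∫ x in (0 : ℝ)..(1 / 2), walsh k (2 * x) := by
    rw [intervalIntegral.integral_of_le (by norm_num), intervalIntegral.integral_of_le (by norm_num),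
      ← integral_Ico_eq_integral_Ioc, ← integral_Ico_eq_integral_Ioc]
    refine setIntegral_congr_fun measurableSet_Ico fun x hx => ?_
    have : Int.fract x = x := Int.fract_eq_self.2 ⟨hx.1, by linarith [hx.2]⟩
    simp only [walsh_two_mul_add k b hb, rademacherBase, this, if_pos hx.2, one_pow, one_mul]
  have h2 : ∫ x in (1 / 2 : ℝ)..1, walsh (2 * k + b) x =
      (-1) ^ b * ∫ x in (1 / 2 : ℝ)..1, walsh k (2 * x) := by
    rw [intervalIntegral.integral_of_le (by norm_num), intervalIntegral.integral_of_le (by norm_num),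
      ← integral_Ico_eq_integral_Ioc, ← integral_Ico_eq_integral_Ioc, ← integral_const_mul]
    refine setIntegral_congr_fun measurableSet_Ico fun x hx => ?_
    have : Int.fract x = x := Int.fract_eq_self.2 ⟨by linarith [hx.1], hx.2⟩
    simp only [walsh_two_mul_add k b hb, rademacherBase, this, if_neg (not_lt.2 hx.1)]
  rw [h1, h2, intervalIntegral.integral_comp_mul_left _ two_ne_zero,
    intervalIntegral.integral_comp_mul_left _ two_ne_zero]
  have h3 := (walsh_periodic k).intervalIntegral_add_eq 1 0
  norm_num at h3 ⊢
  rw [h3]; ring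

lemma integral_walsh (k : ℕ) :
    ∫ x in Set.Ico (0 : ℝ) 1, walsh k x = if k = 0 then 1 else 0 := by
  rw [integral_Ico_eq_integral_Ioc, ← intervalIntegral.integral_of_le zero_le_one]
  induction k using Nat.strong_induction_on with
  | _ k ih =>
    rcases Nat.eq_zero_or_pos k with rfl | hk
    · simp [walsh_zero]
    · have h := integral_walsh_half (k / 2) (k % 2) (Nat.mod_lt _ two_pos)
      rw [Nat.div_add_mod] at h
      rw [h, ih _ (Nat.div_lt_self hk one_lt_two), if_neg hk.ne']
      rcases Nat.mod_two_eq_zero_or_one k with h0 | h0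
      · rw [if_neg (by omega), mul_zero]
      · rw [h0]; norm_num

lemma integrableOn_walsh (k : ℕ) : IntegrableOn (walsh k) (Set.Ico 0 1) :=
  Measure.integrableOn_of_bounded (M := 1) (by simp) (measurable_walsh k).aestronglyMeasurable
    (Filter.Eventually.of_forall fun x => by simp [abs_walsh])

lemma IntegrableOn.mul_walsh {f : ℝ → ℝ} (hf : IntegrableOn f (Set.Ico 0 1)) (k : ℕ) :
    IntegrableOn (fun x => f x * walsh k x) (Set.Ico 0 1) :=
  Integrable.mul_bdd (c := 1) hf (measurable_walsh k).aestronglyMeasurable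
    (Filter.Eventually.of_forall fun x => by simp [abs_walsh])

/-! ### Partial sums -/

lemma walshSum_add {f g : ℝ → ℝ} (hf : IntegrableOn f (Set.Ico 0 1))
    (hg : IntegrableOn g (Set.Ico 0 1)) (m : ℕ) :
    walshSum (f + g) m = walshSum f m + walshSum g m := by
  ext x
  simp only [walshSum, Pi.add_apply, ← Finset.sum_add_distrib, ← add_mul]
  refine Finset.sum_congr rfl fun k _ => ?_
  congr 1
  simp only [walshCoeff, Pi.add_apply, add_mul]
  exact integral_add (IntegrableOn.mul_walsh hf k) (IntegrableOn.mul_walsh hg k)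

lemma walshSum_smul (c : ℝ) (f : ℝ → ℝ) (m : ℕ) :
    walshSum (c • f) m = c • walshSum f m := by
  ext x
  simp only [walshSum, Pi.smul_apply, smul_eq_mul, Finset.mul_sum, walshCoeff, mul_assoc,
    integral_const_mul]

lemma walshSum_zero_fun (m : ℕ) : walshSum 0 m = 0 := by
  ext x; simp [walshSum, walshCoeff]

lemma walshCoeff_walsh (k l : ℕ) : walshCoeff (walsh k) l = if l = k then 1 else 0 := by
  have : ∀ x, walsh k x * walsh l x = walsh (k ^^^ l) x := fun x => by rw [walsh_xor]; rfl
  simp only [walshCoeff, this, integral_walsh, Nat.xor_eq_zero_iff]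
  simp [eq_comm]

lemma walshSum_walsh (k m : ℕ) : walshSum (walsh k) m = if k < m then walsh k else 0 := by
  ext x
  simp only [walshSum, walshCoeff_walsh, ite_mul, one_mul, zero_mul, Finset.sum_ite_eq',
    Finset.mem_range]
  split_ifs <;> rfl

lemma abs_walshSum_le {f : ℝ → ℝ} (m : ℕ) (x : ℝ) :
    |walshSum f m x| ≤ m * ∫ y in Set.Ico (0 : ℝ) 1, |f y| := by
  unfold walshSum
  refine (Finset.abs_sum_le_sum_abs _ _).trans ?_
  rw [← nsmul_eq_mul]
  conv_rhs => rw [← Finset.card_range m]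
  refine Finset.sum_le_card_nsmul _ _ _ fun k _ => ?_
  rw [abs_mul, abs_walsh, mul_one, walshCoeff]
  refine (abs_integral_le_integral_abs).trans_eq ?_
  simp [abs_mul, abs_walsh]

/-! ### Walsh polynomials with spectrum in a given set -/

/-- The linear span of the Walsh functions with index in `A`. -/
noncomputable def walshSpan (A : Set ℕ) : Submodule ℝ (ℝ → ℝ) := Submodule.span ℝ (walsh '' A)

lemma walsh_mem_walshSpan {A : Set ℕ} {k : ℕ} (h : k ∈ A) : walsh k ∈ walshSpan A :=
  Submodule.subset_span ⟨k, h, rfl⟩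

lemma one_mem_walshSpan {A : Set ℕ} (h : 0 ∈ A) : (1 : ℝ → ℝ) ∈ walshSpan A :=
  walsh_zero ▸ walsh_mem_walshSpan h

lemma walshSpan_mono {A B : Set ℕ} (h : A ⊆ B) : walshSpan A ≤ walshSpan B :=
  Submodule.span_mono (Set.image_mono h)

lemma mul_mem_walshSpan {A B C : Set ℕ} {f g : ℝ → ℝ} (hf : f ∈ walshSpan A)
    (hg : g ∈ walshSpan B) (h : ∀ a ∈ A, ∀ b ∈ B, a ^^^ b ∈ C) : f * g ∈ walshSpan C := by
  have := Submodule.mul_mem_mul hf hg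
  rw [walshSpan, walshSpan, Submodule.span_mul_span] at this
  refine Submodule.span_mono ?_ this
  rintro _ ⟨_, ⟨a, ha, rfl⟩, _, ⟨b, hb, rfl⟩, rfl⟩
  exact ⟨a ^^^ b, h a ha b hb, walsh_xor a b⟩

lemma walsh_mul_mem_walshSpan {A C : Set ℕ} {n : ℕ} {f : ℝ → ℝ} (hf : f ∈ walshSpan A)
    (h : ∀ a ∈ A, n ^^^ a ∈ C) : walsh n * f ∈ walshSpan C :=
  mul_mem_walshSpan (walsh_mem_walshSpan (Set.mem_singleton n)) hf
    fun m hm a ha => by rw [Set.mem_singleton_iff.1 hm]; exact h a ha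

lemma measurable_of_mem_walshSpan {A : Set ℕ} {f : ℝ → ℝ} (hf : f ∈ walshSpan A) :
    Measurable f := by
  induction hf using Submodule.span_induction with
  | mem f hf => obtain ⟨k, _, rfl⟩ := hf; exact measurable_walsh k
  | zero => exact measurable_zero
  | add f g _ _ hf hg => exact hf.add hg
  | smul c f _ hf => exact hf.const_smul c

lemma integrableOn_of_mem_walshSpan {A : Set ℕ} {f : ℝ → ℝ} (hf : f ∈ walshSpan A) :
    IntegrableOn f (Set.Ico 0 1) := by
  induction hf using Submodule.span_induction with
  | mem f hf => obtain ⟨k, _, rfl⟩ := hf; exact integrableOn_walsh k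
  | zero => exact integrableOn_zero
  | add f g _ _ hf hg => exact hf.add hg
  | smul c f _ hf => exact hf.smul c

lemma integral_eq_zero_of_mem_walshSpan {A : Set ℕ} {f : ℝ → ℝ} (hf : f ∈ walshSpan A)
    (hA : 0 ∉ A) : ∫ x in Set.Ico (0 : ℝ) 1, f x = 0 := by
  induction hf using Submodule.span_induction with
  | mem f hf =>
    obtain ⟨k, hk, rfl⟩ := hf
    rw [integral_walsh, if_neg (by rintro rfl; exact hA hk)]
  | zero => simp
  | add f g hf hg ihf ihg =>
    have := integral_add (μ := volume.restrict (Set.Ico (0 : ℝ) 1))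
      (integrableOn_of_mem_walshSpan hf) (integrableOn_of_mem_walshSpan hg)
    simpa [ihf, ihg] using this
  | smul c f _ hf => simp [integral_const_mul, hf]

lemma walshSum_eq_self {A : Set ℕ} {f : ℝ → ℝ} {m : ℕ} (hf : f ∈ walshSpan A)
    (hA : ∀ k ∈ A, k < m) : walshSum f m = f := by
  induction hf using Submodule.span_induction with
  | mem f hf => obtain ⟨k, hk, rfl⟩ := hf; rw [walshSum_walsh, if_pos (hA k hk)]
  | zero => exact walshSum_zero_fun m
  | add f g hf hg ihf ihg =>
    rw [walshSum_add (integrableOn_of_mem_walshSpan hf) (integrableOn_of_mem_walshSpan hg), ihf, ihg]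
  | smul c f _ hf => rw [walshSum_smul, hf]

lemma walshSum_eq_zero {A : Set ℕ} {f : ℝ → ℝ} {m : ℕ} (hf : f ∈ walshSpan A)
    (hA : ∀ k ∈ A, m ≤ k) : walshSum f m = 0 := by
  induction hf using Submodule.span_induction with
  | mem f hf => obtain ⟨k, hk, rfl⟩ := hf; rw [walshSum_walsh, if_neg (hA k hk).not_gt]
  | zero => exact walshSum_zero_fun m
  | add f g hf hg ihf ihg =>
    rw [walshSum_add (integrableOn_of_mem_walshSpan hf) (integrableOn_of_mem_walshSpan hg), ihf, ihg,
      add_zero]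
  | smul c f _ hf => rw [walshSum_smul, hf, smul_zero]

lemma exists_abs_walshSum_le {A : Set ℕ} {f : ℝ → ℝ} (hf : f ∈ walshSpan A) :
    ∃ B : ℝ, 0 ≤ B ∧ ∀ m x, |walshSum f m x| ≤ B := by
  induction hf using Submodule.span_induction with
  | mem f hf =>
    obtain ⟨k, hk, rfl⟩ := hf
    refine ⟨1, zero_le_one, fun m x => ?_⟩
    rw [walshSum_walsh]
    split_ifs <;> simp [abs_walsh]
  | zero => exact ⟨0, le_rfl, fun m x => by simp [walshSum_zero_fun]⟩
  | add f g hf hg ihf ihg =>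
    obtain ⟨B, hB, h⟩ := ihf
    obtain ⟨C, hC, h'⟩ := ihg
    refine ⟨B + C, add_nonneg hB hC, fun m x => ?_⟩
    rw [walshSum_add (integrableOn_of_mem_walshSpan hf) (integrableOn_of_mem_walshSpan hg)]
    exact (abs_add_le _ _).trans (add_le_add (h m x) (h' m x))
  | smul c f _ ih =>
    obtain ⟨B, hB, h⟩ := ih
    refine ⟨|c| * B, by positivity, fun m x => ?_⟩
    rw [walshSum_smul, Pi.smul_apply, smul_eq_mul, abs_mul]
    exact mul_le_mul_of_nonneg_left (h m x) (abs_nonneg c)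

/-! ### Binary digits -/

lemma testBit_eq_false_of_log2_lt {n j : ℕ} (h : n.log2 < j) : n.testBit j = false := by
  refine Nat.testBit_lt_two_pow (Nat.lt_log2_self.trans_le ?_)
  exact Nat.pow_le_pow_right two_pos h

lemma xor_lt_self {n k : ℕ} (hk : k ≠ 0) (h : n.testBit k.log2 = true) : n ^^^ k < n := by
  refine Nat.lt_of_testBit k.log2 ?_ h fun j hj => ?_
  · simp [h, Nat.testBit_log2 hk]
  · simp [testBit_eq_false_of_log2_lt hj]

lemma self_lt_xor {n k : ℕ} (hk : k ≠ 0) (h : n.testBit k.log2 = false) : n < n ^^^ k := by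
  refine Nat.lt_of_testBit k.log2 h ?_ fun j hj => ?_
  · simp [h, Nat.testBit_log2 hk]
  · simp [testBit_eq_false_of_log2_lt hj]

lemma xor_mem_dyadic {a b t : ℕ} (ha : a < 2 ^ t) (hb : b ∈ Set.Ico (2 ^ t) (2 ^ (t + 1))) :
    a ^^^ b ∈ Set.Ico (2 ^ t) (2 ^ (t + 1)) := by
  refine ⟨?_, Nat.xor_lt_two_pow (ha.trans (Nat.pow_lt_pow_right one_lt_two t.lt_succ_self)) hb.2⟩
  refine Nat.ge_two_pow_of_testBit ?_
  have hb0 : b ≠ 0 := (Nat.two_pow_pos t |>.trans_le hb.1).ne'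
  have : b.log2 = t := (Nat.log2_eq_iff hb0).2 hb
  rw [Nat.testBit_xor, Nat.testBit_lt_two_pow ha, ← this, Nat.testBit_log2 hb0]
  rfl

lemma log2_of_mem_dyadic {b t : ℕ} (hb : b ∈ Set.Ico (2 ^ t) (2 ^ (t + 1))) : b.log2 = t :=
  (Nat.log2_eq_iff (Nat.two_pow_pos t |>.trans_le hb.1).ne').2 hb

lemma mem_dyadic_log2 {b : ℕ} (hb : b ≠ 0) : b ∈ Set.Ico (2 ^ b.log2) (2 ^ (b.log2 + 1)) :=
  (Nat.log2_eq_iff hb).1 rfl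

/-! ### Sign patterns -/

/-- The places `l` in `[j, D)` at which a run of ones in the binary expansion of `n` ends. -/
def runEnds (n j D : ℕ) : Finset ℕ :=
  (Finset.Ico j D).filter fun l => n.testBit l = true ∧ n.testBit (l + 1) = false

/-- The indices in `[2 ^ j, 2 ^ D)` whose leading digit is a place where `n` has digit `b`. -/
def leadingSet (n j D : ℕ) (b : Bool) : Set ℕ :=
  {k | 2 ^ j ≤ k ∧ k < 2 ^ D ∧ n.testBit k.log2 = b}

lemma leadingSet_mono (n D : ℕ) (b : Bool) {i j : ℕ} (h : i ≤ j) :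
    leadingSet n j D b ⊆ leadingSet n i D b :=
  fun _ hk => ⟨(Nat.pow_le_pow_right two_pos h).trans hk.1, hk.2⟩

lemma two_pow_mem_leadingSet {n j D : ℕ} (h : j < D) :
    2 ^ j ∈ leadingSet n j D (n.testBit j) :=
  ⟨le_rfl, Nat.pow_lt_pow_right one_lt_two h, by rw [Nat.log2_two_pow]⟩

lemma two_pow_xor_mem_leadingSet {n j D k : ℕ} {b : Bool} (hk : k ∈ leadingSet n (j + 1) D b) :
    2 ^ j ^^^ k ∈ leadingSet n j D b := by
  have hk0 : k ≠ 0 := (Nat.two_pow_pos _ |>.trans_le hk.1).ne'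
  have hj : j + 1 ≤ k.log2 := (Nat.le_log2 hk0).2 hk.1
  have hm := xor_mem_dyadic (Nat.pow_lt_pow_right one_lt_two (Nat.lt_of_succ_le hj))
    (mem_dyadic_log2 hk0)
  refine ⟨(Nat.pow_le_pow_right two_pos (by omega)).trans hm.1, ?_, ?_⟩
  · refine hm.2.trans_le (Nat.pow_le_pow_right two_pos ?_)
    exact (Nat.log2_lt hk0).2 hk.2.1
  · rw [log2_of_mem_dyadic hm, hk.2.2]

lemma half_add_mul_mem {n j D : ℕ} {b : Bool} {f : ℝ → ℝ} (t : ℝ)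
    (hf : f ∈ walshSpan (leadingSet n (j + 1) D b)) :
    (1 / 2 : ℝ) • f + (t / 2) • (walsh (2 ^ j) * f) ∈ walshSpan (leadingSet n j D b) := by
  refine add_mem (Submodule.smul_mem _ _ ?_) (Submodule.smul_mem _ _ ?_)
  · exact walshSpan_mono (leadingSet_mono n D b j.le_succ) hf
  · exact walsh_mul_mem_walshSpan hf fun k hk => two_pow_xor_mem_leadingSet hk

/-- A function with values `±1` depending on the digits in `[j, D)`, equal to `1` on the dyadic
atom with signs `t`, whose part with leading digits in the spectrum of `n` is large there. -/
lemma exists_signPattern_from (n D : ℕ) (t : ℕ → ℝ) (ht : ∀ j, t j = 1 ∨ t j = -1)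
    (hn : n.testBit D = false) (d : ℕ) : ∀ j, j + d = D →
    ∃ (P T U : ℝ → ℝ) (c : ℝ), P = c • 1 + T + U ∧
      T ∈ walshSpan (leadingSet n j D true) ∧ U ∈ walshSpan (leadingSet n j D false) ∧
      (∀ y, P y = 1 ∨ P y = -1) ∧ -1 ≤ c ∧ (n.testBit j = false → 0 ≤ c) ∧
      ∀ x, (∀ l, j ≤ l → l < D → t l * rademacher l x = 1) →
        P x = 1 ∧ ((runEnds n j D).card : ℝ) / 2 ≤ T x := by
  induction d with
  | zero =>
    rintro j rfl
    refine ⟨1, 0, 0, 1, by simp, zero_mem _, zero_mem _, fun y => Or.inl rfl, by norm_num,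
      fun _ => zero_le_one, fun x _ => ⟨rfl, ?_⟩⟩
    simp [runEnds]
  | succ d ih =>
    intro j hj
    obtain ⟨P, T, U, c, hP, hT, hU, hPv, hc, hc0, hx⟩ := ih (j + 1) (by omega)
    have hjD : j < D := by omega
    have key : ∀ x, t j * rademacher j x = 1 ∨ t j * rademacher j x = -1 := fun x => by
      rcases ht j with h | h <;> rcases rademacher_eq_or j x with h' | h' <;> simp [h, h']
    have hwj : walsh (2 ^ j) ∈ walshSpan (leadingSet n j D (n.testBit j)) :=
      walsh_mem_walshSpan (two_pow_mem_leadingSet hjD)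
    cases hb : n.testBit j with
    | true =>
      rw [hb] at hwj
      refine ⟨fun y => (t j * rademacher j y - 1) / 2 + (1 + t j * rademacher j y) / 2 * P y,
        ((1 / 2 : ℝ) • T + (t j / 2) • (walsh (2 ^ j) * T)) + ((c + 1) / 2 * t j) • walsh (2 ^ j),
        (1 / 2 : ℝ) • U + (t j / 2) • (walsh (2 ^ j) * U), (c - 1) / 2, ?_,
        add_mem (half_add_mul_mem _ hT) (Submodule.smul_mem _ _ hwj), half_add_mul_mem _ hU,
        fun y => ?_, by linarith, fun h => by simp at h, fun x hxl => ?_⟩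
      · ext y
        simp only [hP, walsh_two_pow, Pi.add_apply, Pi.smul_apply, Pi.mul_apply, Pi.one_apply,
          smul_eq_mul]
        ring
      · rcases key y with h | h <;> rcases hPv y with h' | h' <;> simp only [h, h'] <;> norm_num
      · obtain ⟨h1, h2⟩ := hx x fun l hl => hxl l (by omega)
        have hj1 := hxl j le_rfl hjD
        refine ⟨by simp only [h1, hj1]; norm_num, ?_⟩
        have hTx : (((1 / 2 : ℝ) • T + (t j / 2) • (walsh (2 ^ j) * T)) +
            ((c + 1) / 2 * t j) • walsh (2 ^ j)) x = T x + (c + 1) / 2 := by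
          simp only [walsh_two_pow, Pi.add_apply, Pi.smul_apply, Pi.mul_apply, smul_eq_mul]
          linear_combination (T x / 2 + (c + 1) / 2) * hj1
        rw [hTx]
        cases hb' : n.testBit (j + 1) with
        | true =>
          have : runEnds n j D = runEnds n (j + 1) D := by
            unfold runEnds
            rw [← Finset.insert_Ico_add_one_left_eq_Ico hjD, Finset.filter_insert,
              if_neg (by simp [hb'])]
          rw [this]; linarith
        | false =>
          have : (runEnds n j D).card ≤ (runEnds n (j + 1) D).card + 1 := by
            unfold runEnds
            rw [← Finset.insert_Ico_add_one_left_eq_Ico hjD, Finset.filter_insert,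
              if_pos ⟨hb, hb'⟩]
            exact Finset.card_insert_le _ _
          have : ((runEnds n j D).card : ℝ) ≤ (runEnds n (j + 1) D).card + 1 := by
            exact_mod_cast this
          linarith [hc0 hb']
    | false =>
      rw [hb] at hwj
      refine ⟨fun y => (1 - t j * rademacher j y) / 2 + (1 + t j * rademacher j y) / 2 * P y,
        (1 / 2 : ℝ) • T + (t j / 2) • (walsh (2 ^ j) * T),
        ((1 / 2 : ℝ) • U + (t j / 2) • (walsh (2 ^ j) * U)) + ((c - 1) / 2 * t j) • walsh (2 ^ j),
        (c + 1) / 2, ?_, half_add_mul_mem _ hT,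
        add_mem (half_add_mul_mem _ hU) (Submodule.smul_mem _ _ hwj),
        fun y => ?_, by linarith, fun _ => by linarith, fun x hxl => ?_⟩
      · ext y
        simp only [hP, walsh_two_pow, Pi.add_apply, Pi.smul_apply, Pi.mul_apply, Pi.one_apply,
          smul_eq_mul]
        ring
      · rcases key y with h | h <;> rcases hPv y with h' | h' <;> simp only [h, h'] <;> norm_num
      · obtain ⟨h1, h2⟩ := hx x fun l hl => hxl l (by omega)
        have hj1 := hxl j le_rfl hjD
        refine ⟨by simp only [h1, hj1]; norm_num, ?_⟩
        have hTx : ((1 / 2 : ℝ) • T + (t j / 2) • (walsh (2 ^ j) * T)) x = T x := by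
          simp only [walsh_two_pow, Pi.add_apply, Pi.smul_apply, Pi.mul_apply, smul_eq_mul]
          linear_combination (T x / 2) * hj1
        have : runEnds n j D = runEnds n (j + 1) D := by
          unfold runEnds
          rw [← Finset.insert_Ico_add_one_left_eq_Ico hjD, Finset.filter_insert,
            if_neg (by simp [hb])]
        rw [hTx, this]; exact h2

/-- The variation is twice the number of runs of ones. -/
lemma binVariation_eq (n : ℕ) : binVariation n = 2 * (runEnds n 0 n).card := by
  have h : ∀ m : ℕ, ((binCoeff 0 n + ∑ j ∈ Finset.Icc 1 m,
      ((binCoeff j n : ℤ) - (binCoeff (j - 1) n : ℤ)).natAbs : ℕ) : ℤ) =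
      2 * (runEnds n 0 m).card + binCoeff m n := by
    intro m
    induction m with
    | zero => simp [runEnds]
    | succ m ih =>
      rw [Finset.sum_Icc_succ_top (by omega), ← add_assoc, Nat.cast_add, ih]
      simp only [runEnds, ← Finset.range_eq_Ico, Finset.range_add_one, Finset.filter_insert,
        Nat.add_sub_cancel, binCoeff]
      cases h1 : n.testBit m <;> cases h2 : n.testBit (m + 1) <;>
        simp [Finset.card_insert_of_notMem]
      ring
  have h2 := h n
  rw [binCoeff_eq_zero le_rfl, Nat.cast_zero, add_zero] at h2
  exact Int.ofNat_inj.1 (h2.trans (by push_cast; rfl))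

lemma runEnds_eq {n D : ℕ} (hD : n < 2 ^ D) : runEnds n 0 n = runEnds n 0 D := by
  ext l
  simp only [runEnds, Finset.mem_filter, Finset.mem_Ico, zero_le, true_and]
  refine and_congr_left fun h => ?_
  have h1 := Nat.ge_two_pow_of_testBit h.1
  constructor
  · intro _
    exact (Nat.pow_lt_pow_iff_right one_lt_two).1 (h1.trans_lt hD)
  · intro _
    exact Nat.lt_two_pow_self.trans_le h1

lemma exists_signPattern {n D : ℕ} (hD : n < 2 ^ D) (i : ℕ) :
    ∃ (P T U : ℝ → ℝ) (c : ℝ), P = c • 1 + T + U ∧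
      T ∈ walshSpan (leadingSet n 0 D true) ∧ U ∈ walshSpan (leadingSet n 0 D false) ∧
      (∀ y, P y = 1 ∨ P y = -1) ∧
      ∀ x, (∀ l < D, i.testBit l = true ↔ rademacher l x = -1) →
        P x = 1 ∧ (binVariation n : ℝ) / 4 ≤ T x := by
  obtain ⟨P, T, U, c, hP, hT, hU, hPv, -, -, hx⟩ := exists_signPattern_from n D
    (fun j => if i.testBit j then -1 else 1) (fun j => by split_ifs <;> simp)
    (Nat.testBit_lt_two_pow hD) D 0 (zero_add D)
  refine ⟨P, T, U, c, hP, hT, hU, hPv, fun x h => ?_⟩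
  obtain ⟨h1, h2⟩ := hx x fun l _ hl => by
    rcases rademacher_eq_or l x with h' | h'
    · have : ¬ i.testBit l = true := fun h'' => by
        have := (h l hl).1 h''
        rw [h'] at this; norm_num at this
      simp [this, h']
    · simp [(h l hl).2 h', h']
  refine ⟨h1, ?_⟩
  rw [binVariation_eq, runEnds_eq hD]
  push_cast
  linarith

lemma exists_testBit_iff_rademacher (D : ℕ) (x : ℝ) :
    ∃ i < 2 ^ D, ∀ l < D, i.testBit l = true ↔ rademacher l x = -1 := by
  classical
  refine ⟨Nat.ofBits fun l : Fin D => decide (rademacher l x = -1), Nat.ofBits_lt_two_pow _,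
    fun l hl => ?_⟩
  rw [Nat.testBit_ofBits_lt _ _ hl]
  simp

/-! ### Riesz products -/

/-- The partial products of the Riesz product with factors `1 + P_i w_{N_i}`. -/
noncomputable def riesz (N : ℕ → ℕ) (P : ℕ → ℝ → ℝ) (m : ℕ) : ℝ → ℝ :=
  ∏ i ∈ Finset.range m, (1 + walsh (N i) * P i)

section Riesz

variable {N : ℕ → ℕ} {P : ℕ → ℝ → ℝ} {D : ℕ}

lemma riesz_succ (N : ℕ → ℕ) (P : ℕ → ℝ → ℝ) (m : ℕ) :
    riesz N P (m + 1) = riesz N P m + walsh (N m) * (P m * riesz N P m) := by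
  rw [riesz, Finset.prod_range_succ, ← riesz]; ring

lemma riesz_succ_apply (N : ℕ → ℕ) (P : ℕ → ℝ → ℝ) (m : ℕ) (x : ℝ) :
    riesz N P (m + 1) x = riesz N P m x * (1 + walsh (N m) x * P m x) := by
  rw [riesz, Finset.prod_range_succ, ← riesz]; rfl

lemma riesz_eq_or (hP : ∀ i y, P i y = 1 ∨ P i y = -1) (m : ℕ) (x : ℝ) :
    riesz N P m x = 0 ∨ riesz N P m x = 2 ^ m := by
  induction m with
  | zero => right; simp [riesz]
  | succ m ih =>
    rw [riesz_succ_apply]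
    rcases ih with h | h <;> rcases walsh_eq_or (N m) x with h' | h' <;>
      rcases hP m x with h'' | h'' <;> rw [h, h', h''] <;> norm_num [pow_succ]

lemma riesz_nonneg (hP : ∀ i y, P i y = 1 ∨ P i y = -1) (m : ℕ) (x : ℝ) :
    0 ≤ riesz N P m x := by
  rcases riesz_eq_or hP m x with h | h <;> rw [h]; positivity

variable (hN0 : ∀ i, N i ≠ 0) (hN : StrictMono fun i => (N i).log2)
  (hD : ∀ i, D ≤ (N i).log2) (hP : ∀ i, P i ∈ walshSpan (Set.Iio (2 ^ D)))

include hN0 hD hP in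
lemma riesz_increment_mem {f : ℝ → ℝ} {m : ℕ}
    (hf : f ∈ walshSpan (Set.Iio (2 ^ (N m).log2))) :
    walsh (N m) * (P m * f) ∈
      walshSpan (Set.Ico (2 ^ (N m).log2) (2 ^ ((N m).log2 + 1))) := by
  have h1 : P m * f ∈ walshSpan (Set.Iio (2 ^ (N m).log2)) :=
    mul_mem_walshSpan (hP m) hf fun a ha b hb =>
      Nat.xor_lt_two_pow (lt_of_lt_of_le ha (Nat.pow_le_pow_right two_pos (hD m))) hb
  refine walsh_mul_mem_walshSpan h1 fun a ha => ?_
  rw [Nat.xor_comm]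
  exact xor_mem_dyadic ha (mem_dyadic_log2 (hN0 m))

include hN0 hN hD hP

lemma riesz_sub_one_mem (m : ℕ) : riesz N P m - 1 ∈ walshSpan
    {k | ∃ i < m, k ∈ Set.Ico (2 ^ (N i).log2) (2 ^ ((N i).log2 + 1))} := by
  induction m with
  | zero => simp [riesz]
  | succ m ih =>
    have h1 : riesz N P m ∈ walshSpan (Set.Iio (2 ^ (N m).log2)) := by
      rw [← sub_add_cancel (riesz N P m) 1]
      refine add_mem (walshSpan_mono ?_ ih) (one_mem_walshSpan (Nat.two_pow_pos _))
      rintro k ⟨i, hi, hk⟩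
      exact lt_of_lt_of_le hk.2 (Nat.pow_le_pow_right two_pos (hN hi))
    rw [riesz_succ, add_sub_right_comm]
    refine add_mem (walshSpan_mono ?_ ih)
      (walshSpan_mono ?_ (riesz_increment_mem hN0 hD hP h1))
    · rintro k ⟨i, hi, hk⟩; exact ⟨i, by omega, hk⟩
    · exact fun k hk => ⟨m, by omega, hk⟩

lemma riesz_mem (m : ℕ) : riesz N P m ∈ walshSpan (Set.Iio (2 ^ (N m).log2)) := by
  rw [← sub_add_cancel (riesz N P m) 1]
  refine add_mem (walshSpan_mono ?_ (riesz_sub_one_mem hN0 hN hD hP m))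
    (one_mem_walshSpan (Nat.two_pow_pos _))
  rintro k ⟨i, hi, hk⟩
  exact lt_of_lt_of_le hk.2 (Nat.pow_le_pow_right two_pos (hN hi))

lemma riesz_sub_mem (i d : ℕ) :
    riesz N P (i + 1 + d) - riesz N P (i + 1) ∈ walshSpan (Set.Ici (2 ^ ((N i).log2 + 1))) := by
  induction d with
  | zero => simp
  | succ d ih =>
    rw [← add_assoc, riesz_succ, add_sub_right_comm]
    refine add_mem ih (walshSpan_mono ?_
      (riesz_increment_mem hN0 hD hP (riesz_mem hN0 hN hD hP _)))
    intro k hk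
    have : (N i).log2 < (N (i + 1 + d)).log2 := hN (by omega)
    exact (Nat.pow_le_pow_right two_pos this).trans hk.1

lemma integral_riesz (m : ℕ) : ∫ x in Set.Ico (0 : ℝ) 1, riesz N P m x = 1 := by
  have h := riesz_sub_one_mem hN0 hN hD hP m
  have h0 := integral_eq_zero_of_mem_walshSpan h (by
    rintro ⟨i, _, hk⟩
    exact absurd hk.1 (Nat.two_pow_pos _).not_ge)
  have h1 : (1 : ℝ → ℝ) ∈ walshSpan (Set.univ) := one_mem_walshSpan trivial
  have := integral_add (μ := volume.restrict (Set.Ico (0 : ℝ) 1))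
    (integrableOn_of_mem_walshSpan h) (integrableOn_of_mem_walshSpan h1)
  simp only [Pi.sub_apply, Pi.one_apply] at this h0
  simpa [h0] using this

/-- The partial sums of a Riesz product along its frequencies. -/
lemma walshSum_riesz (hnest : ∀ i j, i ≤ j → (N j).testBit (N i).log2 = true)
    {n : ℕ} (hn : ∀ i, ∀ j < D, (N i).testBit j = n.testBit j) {i m : ℕ} (him : i < m)
    {T U : ℝ → ℝ} {c : ℝ} (hPi : P i = c • 1 + T + U)
    (hT : T ∈ walshSpan (leadingSet n 0 D true)) (hU : U ∈ walshSpan (leadingSet n 0 D false)) :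
    walshSum (riesz N P m) (N i) = riesz N P (i + 1) + walsh (N i) * (T - P i) := by
  obtain ⟨d, rfl⟩ := Nat.exists_eq_add_of_le (Nat.succ_le_of_lt him)
  set F := riesz N P i
  have hlt : ∀ {a : ℕ}, a ≠ 0 → a < 2 ^ D → a.log2 < D := fun h0 h => (Nat.log2_lt h0).2 h
  have hF : F ∈ walshSpan (Set.Iio (N i)) := by
    refine walshSpan_mono (fun k hk => ?_) (riesz_mem hN0 hN hD hP i)
    exact lt_of_lt_of_le hk (Nat.log2_self_le (hN0 i))
  have hPF : walsh (N i) * (P i * (F - 1)) ∈ walshSpan (Set.Iio (N i)) := by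
    have h1 : P i * (F - 1) ∈ walshSpan {k | k ≠ 0 ∧ (N i).testBit k.log2 = true} := by
      refine mul_mem_walshSpan (hP i) (riesz_sub_one_mem hN0 hN hD hP i) ?_
      rintro a ha k ⟨j, hj, hk⟩
      have := xor_mem_dyadic (lt_of_lt_of_le ha (Nat.pow_le_pow_right two_pos (hD j))) hk
      refine ⟨(Nat.two_pow_pos _ |>.trans_le this.1).ne', ?_⟩
      rw [log2_of_mem_dyadic this]
      exact hnest j i hj.le
    exact walsh_mul_mem_walshSpan h1 fun a ha => xor_lt_self ha.1 ha.2
  have hwT : walsh (N i) * T ∈ walshSpan (Set.Iio (N i)) := by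
    refine walsh_mul_mem_walshSpan hT fun a ha => ?_
    have h0 : a ≠ 0 := (Nat.two_pow_pos _ |>.trans_le ha.1).ne'
    exact xor_lt_self h0 (by rw [hn i _ (hlt h0 ha.2.1)]; exact ha.2.2)
  have hwU : walsh (N i) * U ∈ walshSpan (Set.Ici (N i)) := by
    refine walsh_mul_mem_walshSpan hU fun a ha => ?_
    have h0 : a ≠ 0 := (Nat.two_pow_pos _ |>.trans_le ha.1).ne'
    exact (self_lt_xor h0 (by rw [hn i _ (hlt h0 ha.2.1)]; exact ha.2.2)).le
  have hc : c • walsh (N i) ∈ walshSpan (Set.Ici (N i)) :=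
    Submodule.smul_mem _ _ (walsh_mem_walshSpan Set.self_mem_Ici)
  have hG : riesz N P (i + 1 + d) - riesz N P (i + 1) ∈ walshSpan (Set.Ici (N i)) := by
    refine walshSpan_mono (fun k hk => ?_) (riesz_sub_mem hN0 hN hD hP i d)
    exact (Nat.lt_log2_self.le).trans hk
  have hlow : F + walsh (N i) * (P i * (F - 1)) + walsh (N i) * T ∈ walshSpan (Set.Iio (N i)) :=
    add_mem (add_mem hF hPF) hwT
  have hhigh : (riesz N P (i + 1 + d) - riesz N P (i + 1)) + c • walsh (N i) + walsh (N i) * U ∈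
      walshSpan (Set.Ici (N i)) := add_mem (add_mem hG hc) hwU
  have hsplit : riesz N P (i + 1 + d) = (F + walsh (N i) * (P i * (F - 1)) + walsh (N i) * T) +
      ((riesz N P (i + 1 + d) - riesz N P (i + 1)) + c • walsh (N i) + walsh (N i) * U) := by
    rw [riesz_succ]
    ext x
    have : P i x = c + T x + U x := by rw [hPi]; simp
    simp only [Pi.add_apply, Pi.sub_apply, Pi.mul_apply, Pi.smul_apply, smul_eq_mul, Pi.one_apply,
      F]
    linear_combination (walsh (N i) x) * this
  rw [hsplit, walshSum_add (integrableOn_of_mem_walshSpan hlow)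
    (integrableOn_of_mem_walshSpan hhigh), walshSum_eq_self hlow fun k hk => hk,
    walshSum_eq_zero hhigh fun k hk => hk, riesz_succ]
  ring

end Riesz

/-! ### Sequences with nested spectra -/

lemma mem_binSpectrum {j n : ℕ} : j ∈ binSpectrum n ↔ n.testBit j = true := by
  have h : n.testBit j = true → j < n := fun h => Nat.lt_two_pow_self.trans_le
    (Nat.ge_two_pow_of_testBit h)
  rw [binSpectrum, Finset.mem_filter, Finset.mem_range, binCoeff]
  constructor
  · rintro ⟨_, h'⟩
    by_contra h''
    simp [h''] at h'
  · intro h'; exact ⟨h h', by simp [h']⟩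

lemma sup_binSpectrum {n : ℕ} (hn : n ≠ 0) : (binSpectrum n).sup id = n.log2 := by
  refine le_antisymm (Finset.sup_le fun j hj => ?_) ?_
  · exact (Nat.le_log2 hn).2 (Nat.ge_two_pow_of_testBit (mem_binSpectrum.1 hj))
  · exact Finset.le_sup (f := id) (mem_binSpectrum.2 (Nat.testBit_log2 hn))

section Nested

variable {n : ℕ → ℕ}

lemma HasNestedSpectra.testBit_succ (h : HasNestedSpectra n) (h0 : ∀ k, 0 < n k) (k : ℕ) {j : ℕ}
    (hj : j ≤ (n k).log2) : (n (k + 1)).testBit j = (n k).testBit j := by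
  have := congrArg (j ∈ ·) (h k)
  simp only [Finset.mem_inter, mem_binSpectrum, Finset.mem_Iic, sup_binSpectrum (h0 k).ne', hj,
    and_true, eq_iff_iff] at this
  exact Bool.eq_iff_iff.2 this

lemma HasNestedSpectra.strictMono_log2 (h : HasNestedSpectra n) (h0 : ∀ k, 0 < n k)
    (hn : StrictMono n) : StrictMono fun k => (n k).log2 := by
  refine strictMono_nat_of_lt_succ fun k => ?_
  by_contra hk
  have hk : (n (k + 1)).log2 ≤ (n k).log2 := not_lt.1 hk
  refine (hn k.lt_succ_self).ne' (Nat.eq_of_testBit_eq fun j => ?_)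
  rcases le_or_gt j (n k).log2 with hj | hj
  · exact h.testBit_succ h0 k hj
  · rw [testBit_eq_false_of_log2_lt hj, testBit_eq_false_of_log2_lt (hk.trans_lt hj)]

lemma HasNestedSpectra.testBit_eq (h : HasNestedSpectra n) (h0 : ∀ k, 0 < n k)
    (hn : StrictMono n) {k l : ℕ} (hkl : k ≤ l) {j : ℕ} (hj : j ≤ (n k).log2) :
    (n l).testBit j = (n k).testBit j := by
  induction l, hkl using Nat.le_induction with
  | base => rfl
  | succ l hkl ih =>
    rw [h.testBit_succ h0 l (hj.trans ((h.strictMono_log2 h0 hn).monotone hkl)), ih]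

/-- The nonnegative function with integral one, large on a small set, whose partial sums along the
sequence reach the order of the variation of `n ν` everywhere. -/
lemma exists_riesz_peak (h : HasNestedSpectra n) (h0 : ∀ k, 0 < n k) (hn : StrictMono n) (ν : ℕ) :
    ∃ F : ℝ → ℝ, F ∈ walshSpan Set.univ ∧ (∀ x, F x = 0 ∨ F x = 2 ^ (2 * n ν)) ∧
      ∫ x in Set.Ico (0 : ℝ) 1, F x = 1 ∧
      ∀ x, ∃ k ≤ ν + 2 * n ν, (binVariation (n ν) : ℝ) / 4 - 1 ≤ |walshSum F (n k) x| := by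
  set D := (n ν).log2 + 1 with hDdef
  have hnD : n ν < 2 ^ D := Nat.lt_log2_self
  choose P T U c hPeq hT hU hPv hx using exists_signPattern hnD
  set N : ℕ → ℕ := fun i => n (ν + 1 + i) with hN
  have hM := h.strictMono_log2 h0 hn
  have hN0 : ∀ i, N i ≠ 0 := fun i => (h0 _).ne'
  have hNm : StrictMono fun i => (N i).log2 := fun i j hij => hM (by omega)
  have hD : ∀ i, D ≤ (N i).log2 := fun i => hM (show ν < ν + 1 + i by omega)
  have hP : ∀ i, P i ∈ walshSpan (Set.Iio (2 ^ D)) := fun i => by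
    rw [hPeq]
    refine add_mem (add_mem (Submodule.smul_mem _ _ (one_mem_walshSpan (Nat.two_pow_pos _)))
      (walshSpan_mono ?_ (hT i))) (walshSpan_mono ?_ (hU i))
    · exact fun k hk => hk.2.1
    · exact fun k hk => hk.2.1
  refine ⟨riesz N P (2 * n ν), walshSpan_mono (Set.subset_univ _) (riesz_mem hN0 hNm hD hP _),
    riesz_eq_or hPv _, integral_riesz hN0 hNm hD hP _, fun x => ?_⟩
  obtain ⟨i, hi, hix⟩ := exists_testBit_iff_rademacher D x
  have hi' : i < 2 * n ν := by
    refine hi.trans_le ?_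
    rw [hDdef, pow_succ']
    exact Nat.mul_le_mul_left 2 (Nat.log2_self_le (h0 ν).ne')
  refine ⟨ν + 1 + i, by omega, ?_⟩
  have key := walshSum_riesz hN0 hNm hD hP
    (fun a b hab => by
      rw [hN]
      rw [h.testBit_eq h0 hn (show ν + 1 + a ≤ ν + 1 + b by omega) le_rfl]
      exact Nat.testBit_log2 (h0 _).ne')
    (n := n ν) (fun a j hj => h.testBit_eq h0 hn (by omega) (by omega)) hi' (hPeq i) (hT i) (hU i)
  obtain ⟨h1, h2⟩ := hx i x hix
  have hval : walshSum (riesz N P (2 * n ν)) (n (ν + 1 + i)) x =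
      riesz N P i x * (1 + walsh (N i) x) + walsh (N i) x * (T i x - 1) := by
    have := congrFun key x
    rw [Pi.add_apply, riesz_succ_apply, Pi.mul_apply, Pi.sub_apply, h1, mul_one] at this
    exact this
  rw [hval]
  rcases walsh_eq_or (N i) x with hw | hw
  · rw [hw]
    refine le_trans ?_ (le_abs_self _)
    have := riesz_nonneg (N := N) hPv i x
    linarith
  · rw [hw]
    refine le_trans ?_ (neg_le_abs _)
    linarith

end Nested

/-! ### The interpolating function -/

lemma phiNode_pos (n : ℕ → ℕ) (i : ℕ) : 0 < phiNode n i := by unfold phiNode; positivity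

lemma phiNode_strictMono {n : ℕ → ℕ} (hn : StrictMono n) : StrictMono (phiNode n) := by
  intro i j hij
  have := hn hij
  exact pow_lt_pow_right₀ one_lt_two (by omega)

lemma exists_phiNode_le_lt {n : ℕ → ℕ} (hn : StrictMono n) {u : ℝ} (hu : phiNode n 0 ≤ u) :
    ∃ i, phiNode n i ≤ u ∧ u < phiNode n (i + 1) := by
  have hex : ∃ j, u < phiNode n j := by
    obtain ⟨j, hj⟩ := pow_unbounded_of_one_lt u (one_lt_two (α := ℝ))
    refine ⟨j, hj.trans_le (pow_le_pow_right₀ one_le_two ?_)⟩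
    have := hn.id_le j
    simp only [id] at this
    omega
  classical
  have h0 : Nat.find hex ≠ 0 := fun h => by
    have := Nat.find_spec hex
    rw [h] at this
    exact absurd hu this.not_ge
  obtain ⟨i, hi⟩ := Nat.exists_eq_succ_of_ne_zero h0
  refine ⟨i, ?_, ?_⟩
  · exact not_lt.1 (Nat.find_min hex (by omega))
  · have := Nat.find_spec hex
    rwa [hi] at this

/-- On each segment, `phiSeq` is a convex combination of its values at the nodes. -/
lemma phiSeq_eq {n : ℕ → ℕ} (hn : StrictMono n) {u : ℝ} {i : ℕ} (h1 : phiNode n i ≤ u)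
    (h2 : u < phiNode n (i + 1)) : ∃ t : ℝ, 0 ≤ t ∧ t ≤ 1 ∧
      u = phiNode n i * (1 - t) + phiNode n (i + 1) * t ∧
      phiSeq n u = phiNode n i * (1 - t) * binVariation (n i) +
        phiNode n (i + 1) * t * binVariation (n (i + 1)) := by
  have hm := phiNode_strictMono hn
  have hset : {j : ℕ | phiNode n j ≤ u} = Set.Iic i := by
    ext j
    simp only [Set.mem_ofPred_eq, Set.mem_Iic]
    constructor
    · intro hj
      exact Nat.lt_succ_iff.1 (hm.lt_iff_lt.1 (hj.trans_lt h2))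
    · intro hj
      exact (hm.monotone hj).trans h1
  have hpos : 0 < phiNode n (i + 1) - phiNode n i := sub_pos.2 (hm i.lt_succ_self)
  refine ⟨(u - phiNode n i) / (phiNode n (i + 1) - phiNode n i),
    div_nonneg (sub_nonneg.2 h1) hpos.le, (div_le_one hpos).2 (by linarith), ?_, ?_⟩
  · field_simp; ring
  · have h0 : ¬ u < phiNode n 0 := not_lt.2 ((hm.monotone (Nat.zero_le i)).trans h1)
    simp only [phiSeq, if_neg h0, hset, csSup_Iic, phiValue]
    ring

lemma phiSeq_of_lt {n : ℕ → ℕ} {u : ℝ} (h : u < phiNode n 0) :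
    phiSeq n u = binVariation (n 0) * u := by
  have := (phiNode_pos n 0).ne'
  rw [phiSeq, if_pos h, phiValue]
  field_simp

lemma phiSeq_le {n : ℕ → ℕ} (hn : StrictMono n) {u C : ℝ} {i : ℕ} (h1 : phiNode n i ≤ u)
    (h2 : u < phiNode n (i + 1)) (hi : (binVariation (n i) : ℝ) ≤ C)
    (hi' : (binVariation (n (i + 1)) : ℝ) ≤ C) : phiSeq n u ≤ C * u := by
  obtain ⟨t, ht0, ht1, hu, hphi⟩ := phiSeq_eq hn h1 h2
  have a := mul_le_mul_of_nonneg_left hi (mul_nonneg (phiNode_pos n i).le (sub_nonneg.2 ht1))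
  have b := mul_le_mul_of_nonneg_left hi' (mul_nonneg (phiNode_pos n (i + 1)).le ht0)
  rw [hphi, hu]
  linarith

lemma le_phiSeq {n : ℕ → ℕ} (hn : StrictMono n) {u C : ℝ} {i : ℕ} (h1 : phiNode n i ≤ u)
    (h2 : u < phiNode n (i + 1)) (hi : C ≤ (binVariation (n i) : ℝ))
    (hi' : C ≤ (binVariation (n (i + 1)) : ℝ)) : C * u ≤ phiSeq n u := by
  obtain ⟨t, ht0, ht1, hu, hphi⟩ := phiSeq_eq hn h1 h2
  have a := mul_le_mul_of_nonneg_left hi (mul_nonneg (phiNode_pos n i).le (sub_nonneg.2 ht1))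
  have b := mul_le_mul_of_nonneg_left hi' (mul_nonneg (phiNode_pos n (i + 1)).le ht0)
  rw [hphi, hu]
  linarith

lemma abs_phiSeq_le {n : ℕ → ℕ} (hn : StrictMono n) {ν : ℕ}
    (hV : ∀ i < ν, binVariation (n i) ≤ binVariation (n ν)) {u : ℝ} (hu0 : 0 ≤ u)
    (hu : u < phiNode n ν) : |phiSeq n u| ≤ binVariation (n ν) * u := by
  have hV' : ∀ i ≤ ν, (binVariation (n i) : ℝ) ≤ binVariation (n ν) := fun i hi => by
    rcases hi.lt_or_eq with h | rfl
    · exact_mod_cast hV i h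
    · exact le_rfl
  rcases lt_or_ge u (phiNode n 0) with h | h
  · rw [phiSeq_of_lt h, abs_of_nonneg (by positivity)]
    exact mul_le_mul_of_nonneg_right (hV' 0 (Nat.zero_le ν)) hu0
  · obtain ⟨i, h1, h2⟩ := exists_phiNode_le_lt hn h
    have hi : i < ν := (phiNode_strictMono hn).lt_iff_lt.1 (h1.trans_lt hu)
    have := le_phiSeq hn h1 h2 (Nat.cast_nonneg _) (Nat.cast_nonneg _)
    rw [abs_of_nonneg (by linarith)]
    exact phiSeq_le hn h1 h2 (hV' i hi.le) (hV' (i + 1) hi)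

lemma binVariation_sq_le (n : ℕ) : (binVariation n : ℝ) ^ 2 ≤ 4 * 2 ^ (2 * n) := by
  have h1 : (runEnds n 0 n).card ≤ n := by
    refine (Finset.card_filter_le _ _).trans ?_
    simp
  have h2 : ((runEnds n 0 n).card : ℝ) ≤ 2 ^ n := by
    exact_mod_cast h1.trans Nat.lt_two_pow_self.le
  have h3 : (binVariation n : ℝ) = 2 * (runEnds n 0 n).card := by
    exact_mod_cast binVariation_eq n
  rw [h3, mul_pow, mul_comm 2 n, pow_mul]
  have := pow_le_pow_left₀ (Nat.cast_nonneg _) h2 2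
  linarith

/-! ### Peak functions with prescribed size -/

/-- The data of a multiple of an indicator function of a small set, whose partial sums reach the
size `R` everywhere along the sequence. -/
structure IsPeak (n : ℕ → ℕ) (φ : ℝ≥0 → ℝ≥0) (R η : ℝ) (Q : Set ℝ) (H B : ℝ) (N : ℕ) : Prop where
  measurableSet : MeasurableSet Q
  le_height : R ≤ H
  bound_nonneg : 0 ≤ B
  integral_le : H * (volume.restrict (Set.Ico (0 : ℝ) 1)).real Q ≤ η
  phi_integral_le : φ (2 * H).toNNReal * (volume.restrict (Set.Ico (0 : ℝ) 1)).real Q ≤ η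
  abs_walshSum_le : ∀ m x, |walshSum (Q.indicator fun _ => H) m x| ≤ B
  le_abs_walshSum : ∀ x, ∃ k, n k ≤ N ∧ R ≤ |walshSum (Q.indicator fun _ => H) (n k) x|

lemma exists_isPeak {n : ℕ → ℕ} (hn : StrictMono n) (h0 : ∀ k, 0 < n k)
    (hnest : HasNestedSpectra n) (hV : HasUnboundedVariation n) {φ : ℝ≥0 → ℝ≥0}
    (hφ : (fun u : ℝ≥0 => (φ u : ℝ)) =o[Filter.atTop] fun u : ℝ≥0 => phiSeq n (u : ℝ))
    {R η : ℝ} (hR : 1 ≤ R) (hη : 0 < η) : ∃ Q H B N, IsPeak n φ R η Q H B N := by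
  have hε : 0 < η / (16 * R) := by positivity
  obtain ⟨U, hU⟩ := Filter.eventually_atTop.1 (hφ.bound hε)
  obtain ⟨m, hm⟩ := exists_nat_ge (max (max 8 (8 * R / η)) (max (16 * R) U))
  simp only [max_le_iff] at hm
  obtain ⟨⟨hm8, hmη⟩, hmR, hmU⟩ := hm
  have hex : ∃ k, m < binVariation (n k) := by
    by_contra! hcon
    exact hV ⟨m, by rintro _ ⟨k, rfl⟩; exact hcon k⟩
  classical
  obtain ⟨ν, hν, hmin⟩ : ∃ ν, m < binVariation (n ν) ∧ ∀ i < ν, binVariation (n i) ≤ m :=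
    ⟨Nat.find hex, Nat.find_spec hex, fun i hi => not_lt.1 (Nat.find_min hex hi)⟩
  obtain ⟨F, hF, hFv, hFi, hFx⟩ := exists_riesz_peak hnest h0 hn ν
  set K := 2 * n ν with hK
  set V : ℝ := (binVariation (n ν) : ℝ) with hVdef
  have hmV : (m : ℝ) < V := by rw [hVdef]; exact_mod_cast hν
  have hV0 : 0 < V := by linarith
  have hVsq : V ^ 2 ≤ 4 * 2 ^ K := binVariation_sq_le (n ν)
  set a : ℝ := 8 * R / V with ha
  have ha0 : 0 < a := by positivity
  have haV : a * V = 8 * R := by rw [ha]; field_simp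
  have ha1 : 2 * a < 1 := by
    by_contra! hcon
    nlinarith
  have haη : a ≤ η := by
    have : 8 * R ≤ V * η := by
      have := (div_le_iff₀ hη).1 hmη
      nlinarith
    rw [ha, div_le_iff₀ hV0]; linarith
  set H : ℝ := a * 2 ^ K with hH
  have hHV : 2 * R * V ≤ H := by
    have : 2 * R * V * V ≤ H * V := by
      have e : H * V = 8 * R * 2 ^ K := by rw [hH, ← haV]; ring
      rw [e]; nlinarith
    exact le_of_mul_le_mul_right this hV0
  set Q : Set ℝ := {x | F x ≠ 0} with hQ
  have hQm : MeasurableSet Q := (measurable_of_mem_walshSpan hF) (measurableSet_singleton 0).compl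
  have hFQ : F = Q.indicator fun _ => (2 : ℝ) ^ K := by
    ext x
    by_cases hx : F x = 0
    · simp [hQ, hx]
    · rw [Set.indicator_of_mem (show x ∈ Q from hx)]
      exact (hFv x).resolve_left hx
  have hg : (Q.indicator fun _ => H) = a • F := by
    rw [hFQ]
    ext x
    by_cases hx : x ∈ Q <;> simp [hx, hH]
  have hμ : (volume.restrict (Set.Ico (0 : ℝ) 1)).real Q * 2 ^ K = 1 := by
    have h1 := hFi
    rwa [hFQ, integral_indicator_const _ hQm, smul_eq_mul] at h1
  obtain ⟨B, hB0, hB⟩ := exists_abs_walshSum_le (Submodule.smul_mem _ a hF)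
  set μQ := (volume.restrict (Set.Ico (0 : ℝ) 1)).real Q
  refine ⟨Q, H, B, n (ν + K), hQm, by nlinarith, hB0, ?_, ?_, ?_, fun x => ?_⟩
  · rw [hH, mul_right_comm, mul_assoc, hμ, mul_one]
    exact haη
  · have hH0 : 0 ≤ 2 * H := by positivity
    have h1 : (φ (2 * H).toNNReal : ℝ) ≤ η / (16 * R) * (V * (2 * H)) := by
      have h2 := hU (2 * H).toNNReal ((Real.le_toNNReal_iff_coe_le hH0).2 (by nlinarith))
      rw [Real.norm_of_nonneg (NNReal.coe_nonneg _), Real.norm_eq_abs,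
        Real.coe_toNNReal _ hH0] at h2
      refine h2.trans (mul_le_mul_of_nonneg_left ?_ hε.le)
      refine abs_phiSeq_le hn (fun i hi => (hmin i hi).trans hν.le) hH0 ?_
      calc 2 * H = 2 * a * 2 ^ K := by rw [hH]; ring
        _ < 1 * 2 ^ K := mul_lt_mul_of_pos_right ha1 (by positivity)
        _ = phiNode n ν := one_mul _
    calc (φ (2 * H).toNNReal : ℝ) * μQ ≤ η / (16 * R) * (V * (2 * H)) * μQ :=
          mul_le_mul_of_nonneg_right h1 measureReal_nonneg
      _ = η / (16 * R) * (2 * (a * V)) * (μQ * 2 ^ K) := by rw [hH]; ring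
      _ = η := by rw [haV, hμ]; field_simp; norm_num
      _ ≤ η := le_rfl
  · rw [hg]; exact hB
  · obtain ⟨k, hk, hkx⟩ := hFx x
    refine ⟨k, hn.monotone hk, ?_⟩
    rw [hg, walshSum_smul, Pi.smul_apply, smul_eq_mul, abs_mul, abs_of_pos ha0]
    have : a * (V / 8) ≤ a * |walshSum F (n k) x| :=
      mul_le_mul_of_nonneg_left (by linarith) ha0.le
    linarith

/-! ### Superposition of peaks -/

/-- Peaks can be chosen one after another, each one much higher than the previous ones and with
integral much smaller than the reciprocals of the frequencies used so far. -/
lemma exists_peak_seq {n : ℕ → ℕ} {φ : ℝ≥0 → ℝ≥0}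
    (h : ∀ R η : ℝ, 1 ≤ R → 0 < η → ∃ Q H B N, IsPeak n φ R η Q H B N) :
    ∃ (R η H B : ℕ → ℝ) (Q : ℕ → Set ℝ) (N : ℕ → ℕ),
      (∀ m, IsPeak n φ (R m) (η m) (Q m) (H m) (B m) (N m)) ∧
      (∀ m, m + ∑ j ∈ Finset.range m, (B j + H j) + 1 ≤ R m) ∧ (∀ m, 0 < η m) ∧ η 0 = 1 ∧
      ∀ m, η (m + 1) = η m / 2 / (1 + N m) := by
  have h' : ∀ p : {p : ℝ × ℝ // 1 ≤ p.1 ∧ 0 < p.2}, ∃ Q H B N, IsPeak n φ p.1.1 p.1.2 Q H B N :=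
    fun p => h _ _ p.2.1 p.2.2
  choose Q H B N hp using h'
  let s : ℕ → {p : ℝ × ℝ // 1 ≤ p.1 ∧ 0 < p.2} := fun m => Nat.rec ⟨(1, 1), le_rfl, one_pos⟩
    (fun _ p => ⟨(p.1.1 + B p + H p + 1, p.1.2 / 2 / (1 + N p)), by
      have h1 := (hp p).bound_nonneg
      have h2 := (hp p).le_height
      have h3 := p.2.1
      dsimp only
      linarith, by
      have h4 := p.2.2
      dsimp only
      positivity⟩) m
  have hs : ∀ m, (s (m + 1)).1 = ((s m).1.1 + B (s m) + H (s m) + 1,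
    (s m).1.2 / 2 / (1 + N (s m))) := fun m => rfl
  refine ⟨fun m => (s m).1.1, fun m => (s m).1.2, fun m => H (s m), fun m => B (s m),
    fun m => Q (s m), fun m => N (s m), fun m => hp _, fun m => ?_, fun m => (s m).2.2, rfl,
    fun m => rfl⟩
  dsimp only
  induction m with
  | zero => simp [s]
  | succ m ih =>
    rw [Finset.sum_range_succ, hs]
    push_cast
    linarith

lemma exists_forall_iSup_walshSum_eq_top {n : ℕ → ℕ} {φ : ℝ≥0 → ℝ≥0} (hφ : Monotone φ)
    (h : ∀ R η : ℝ, 1 ≤ R → 0 < η → ∃ Q H B N, IsPeak n φ R η Q H B N) :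
    ∃ f : ℝ → ℝ, MemPhiL φ (Set.Ico 0 1) f ∧ IntegrableOn f (Set.Ico 0 1) ∧
      ∀ x, (⨆ k, ‖walshSum f (n k) x‖ₑ) = ∞ := by
  obtain ⟨R, η, H, B, Q, N, hp, hR, hη, hη0, hηs⟩ := exists_peak_seq h
  set μ := volume.restrict (Set.Ico (0 : ℝ) 1) with hμ
  have hB : ∀ j, 0 ≤ B j := fun j => (hp j).bound_nonneg
  have hH1 : ∀ m, 1 ≤ H m ∧ 0 ≤ ∑ j ∈ Finset.range m, H j := by
    intro m
    induction m using Nat.strong_induction_on with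
    | _ m ih =>
      have h1 : ∀ j ∈ Finset.range m, 0 ≤ H j := fun j hj => by
        linarith [(ih j (Finset.mem_range.1 hj)).1]
      have h2 := Finset.sum_nonneg h1
      have h3 := Finset.sum_nonneg fun j (_ : j ∈ Finset.range m) => hB j
      have h4 := hR m
      rw [Finset.sum_add_distrib] at h4
      have h5 : (0 : ℝ) ≤ m := Nat.cast_nonneg m
      exact ⟨by linarith [(hp m).le_height], h2⟩
  have hH0 : ∀ m, 0 ≤ H m := fun m => zero_le_one.trans (hH1 m).1
  have hηhalf : ∀ m, η (m + 1) ≤ η m * (1 / 2) := fun m => by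
    rw [hηs, div_div, ← div_eq_mul_one_div]
    have := hη m
    gcongr
    have : (0 : ℝ) ≤ N m := Nat.cast_nonneg _
    linarith
  have hηgeo : ∀ m j, η (j + m) ≤ η m * (1 / 2) ^ j := fun m j => by
    induction j with
    | zero => simp
    | succ j ih =>
      rw [add_right_comm, pow_succ, ← mul_assoc]
      exact (hηhalf _).trans (mul_le_mul_of_nonneg_right ih (by norm_num))
  have hηpow : ∀ m, η m ≤ (1 / 2) ^ m := fun m => by simpa [hη0] using hηgeo 0 m
  set g : ℕ → ℝ → ℝ := fun m => (Q m).indicator fun _ => H m with hg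
  have hgm : ∀ m, Measurable (g m) := fun m => measurable_const.indicator (hp m).measurableSet
  have hg0 : ∀ m x, 0 ≤ g m x := fun m x => Set.indicator_nonneg (fun _ _ => hH0 m) x
  have hgint : ∀ m, Integrable (g m) μ := fun m =>
    (integrable_const (H m)).indicator (hp m).measurableSet
  have hgi : ∀ m, ∫ x, |g m x| ∂μ ≤ η m := fun m => by
    have e : ∀ x, |g m x| = g m x := fun x => abs_of_nonneg (hg0 m x)
    simp only [e]
    change ∫ x, (Q m).indicator (fun _ => H m) x ∂μ ≤ η m
    rw [integral_indicator_const _ (hp m).measurableSet, smul_eq_mul, mul_comm]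
    exact (hp m).integral_le
  have hgeo : Summable fun m : ℕ => ((1 : ℝ) / 2) ^ m := summable_geometric_two
  set f : ℝ → ℝ := fun x => ∑' m, g m x with hf
  have hfm : Measurable f := Measurable.tsum hgm
  have hμQ : ∀ m, μ.real (Q m) ≤ (1 / 2) ^ m := fun m => by
    have h1 := (hp m).integral_le
    have h2 : 1 * μ.real (Q m) ≤ H m * μ.real (Q m) :=
      mul_le_mul_of_nonneg_right (hH1 m).1 measureReal_nonneg
    linarith [hηpow m]
  have hgeo' : (∑' m : ℕ, ENNReal.ofReal ((1 / 2) ^ m)) ≠ ∞ := hgeo.tsum_ofReal_ne_top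
  refine ⟨f, ⟨hfm.aemeasurable, ?_⟩, ⟨hfm.aestronglyMeasurable, ?_⟩, fun x => ?_⟩
  · have hfin : ∀ᵐ x ∂μ, {m | x ∈ Q m}.Finite := by
      refine ae_finite_setOfPred_mem (ne_top_of_le_ne_top hgeo' (ENNReal.tsum_le_tsum fun m => ?_))
      rw [← ofReal_measureReal]
      exact ENNReal.ofReal_le_ofReal (hμQ m)
    have hpt : ∀ᵐ x ∂μ, (φ ‖f x‖₊ : ℝ≥0∞) ≤
        φ 0 + ∑' m, (Q m).indicator (fun _ => (φ (2 * H m).toNNReal : ℝ≥0∞)) x := by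
      filter_upwards [hfin] with x hx
      have hsum : f x = ∑ m ∈ hx.toFinset, g m x := tsum_eq_sum fun m hm => by
        simp only [Set.Finite.mem_toFinset, Set.mem_ofPred_eq] at hm
        exact Set.indicator_of_notMem hm _
      rcases hx.toFinset.eq_empty_or_nonempty with he | hne
      · rw [hsum, he]; simp
      · set M := hx.toFinset.max' hne with hM
        have hMQ : x ∈ Q M := by
          have := hx.toFinset.max'_mem hne
          simpa using this
        have hfx : f x ≤ 2 * H M := by
          calc f x ≤ ∑ m ∈ Finset.range (M + 1), g m x := by
                rw [hsum]
                refine Finset.sum_le_sum_of_subset_of_nonneg (fun m hm => ?_) fun m _ _ => hg0 m x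
                exact Finset.mem_range.2 (Nat.lt_succ_of_le (Finset.le_max' _ m hm))
            _ ≤ ∑ m ∈ Finset.range (M + 1), H m := Finset.sum_le_sum fun m _ =>
                Set.indicator_le_self' (fun _ _ => hH0 m) x
            _ ≤ 2 * H M := by
                rw [Finset.sum_range_succ]
                have h3 := Finset.sum_nonneg fun j (_ : j ∈ Finset.range M) => hB j
                have h4 := hR M
                rw [Finset.sum_add_distrib] at h4
                have h5 : (0 : ℝ) ≤ M := Nat.cast_nonneg M
                linarith [(hp M).le_height]
        have hf0 : 0 ≤ f x := tsum_nonneg fun m => hg0 m x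
        have hφx : φ ‖f x‖₊ ≤ φ (2 * H M).toNNReal := by
          refine hφ ((Real.le_toNNReal_iff_coe_le (by linarith [hH0 M])).2 ?_)
          rw [coe_nnnorm, Real.norm_of_nonneg hf0]
          exact hfx
        refine le_add_left (le_trans ?_ (ENNReal.le_tsum M))
        rw [Set.indicator_of_mem hMQ]
        exact_mod_cast hφx
    refine (lintegral_mono_ae hpt).trans_lt ?_
    rw [lintegral_add_left measurable_const, lintegral_tsum fun m =>
      (measurable_const.indicator (hp m).measurableSet).aemeasurable]
    refine ENNReal.add_lt_top.2 ⟨by simp [hμ], ?_⟩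
    refine (lt_top_iff_ne_top.2 (ne_top_of_le_ne_top hgeo' (ENNReal.tsum_le_tsum fun m => ?_)))
    rw [lintegral_indicator_const (hp m).measurableSet, ← ofReal_measureReal,
      ← ENNReal.ofReal_coe_nnreal, ← ENNReal.ofReal_mul (NNReal.coe_nonneg _)]
    exact ENNReal.ofReal_le_ofReal ((hp m).phi_integral_le.trans (hηpow m))
  · refine (lintegral_mono fun x => enorm_tsum_le_tsum_enorm).trans_lt ?_
    rw [lintegral_tsum fun m => (hgm m).enorm.aemeasurable]
    refine (lt_top_iff_ne_top.2 (ne_top_of_le_ne_top hgeo' (ENNReal.tsum_le_tsum fun m => ?_)))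
    rw [← ofReal_integral_norm_eq_lintegral_enorm (hgint m)]
    exact ENNReal.ofReal_le_ofReal ((hgi m).trans (hηpow m))
  · have hcoeff : ∀ k, HasSum (fun m => walshCoeff (g m) k) (walshCoeff f k) := fun k => by
      have h1 := hasSum_integral_of_summable_integral_norm
        (F := fun m x => g m x * walsh k x) (μ := μ)
        (fun m => IntegrableOn.mul_walsh (hgint m) k) (by
          refine Summable.of_nonneg_of_le (fun m => integral_nonneg fun x => norm_nonneg _)
            (fun m => ?_) hgeo
          simp only [norm_mul, Real.norm_eq_abs, abs_walsh, mul_one]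
          exact (hgi m).trans (hηpow m))
      simp only [tsum_mul_right] at h1
      exact h1
    have hsumm : ∀ M, HasSum (fun m => walshSum (g m) M x) (walshSum f M x) := fun M =>
      hasSum_sum fun k _ => (hcoeff k).mul_right _
    refine ENNReal.eq_top_of_forall_nnreal_le fun r => ?_
    obtain ⟨m, hm⟩ := exists_nat_gt (r : ℝ)
    obtain ⟨k, hkN, hk⟩ := (hp m).le_abs_walshSum x
    refine le_trans ?_ (le_iSup _ k)
    have hsplit := (hsumm (n k)).summable.sum_add_tsum_nat_add (m + 1)
    rw [(hsumm (n k)).tsum_eq, Finset.sum_range_succ] at hsplit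
    have hhead : |∑ j ∈ Finset.range m, walshSum (g j) (n k) x| ≤ ∑ j ∈ Finset.range m, B j :=
      (Finset.abs_sum_le_sum_abs _ _).trans
        (Finset.sum_le_sum fun j _ => (hp j).abs_walshSum_le _ _)
    have htail : |∑' j, walshSum (g (j + (m + 1))) (n k) x| ≤ 1 := by
      have h1 : ∀ j, ‖walshSum (g (j + (m + 1))) (n k) x‖ ≤
          (n k * η (m + 1)) * (1 / 2) ^ j := fun j => by
        rw [Real.norm_eq_abs, mul_assoc]
        refine (abs_walshSum_le _ _).trans (mul_le_mul_of_nonneg_left ?_ (Nat.cast_nonneg _))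
        exact (hgi _).trans (hηgeo _ _)
      have h2 := tsum_of_norm_bounded (hasSum_geometric_two.mul_left (n k * η (m + 1))) h1
      rw [Real.norm_eq_abs] at h2
      refine h2.trans ?_
      have h3 : (n k : ℝ) ≤ N m := by exact_mod_cast hkN
      have h4 : η m ≤ 1 := (hηpow m).trans (pow_le_one₀ (by norm_num) (by norm_num))
      have h5 : (0 : ℝ) ≤ N m := Nat.cast_nonneg _
      have h6 := hη m
      rw [hηs, show (n k : ℝ) * (η m / 2 / (1 + N m)) * 2 = n k * η m / (1 + N m) by ring,
        div_le_one (by linarith)]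
      nlinarith
    have hRm := hR m
    rw [Finset.sum_add_distrib] at hRm
    have hHm := (hH1 m).2
    have hlow : (m : ℝ) ≤ |walshSum f (n k) x| := by
      rw [← hsplit]
      set a := ∑ j ∈ Finset.range m, walshSum (g j) (n k) x
      set c := ∑' j, walshSum (g (j + (m + 1))) (n k) x
      have h1 : |walshSum (g m) (n k) x| ≤
          |a + walshSum (g m) (n k) x + c| + |a| + |c| := by
        calc |walshSum (g m) (n k) x| = |(a + walshSum (g m) (n k) x + c) - a - c| := by
              congr 1; ring
          _ ≤ |(a + walshSum (g m) (n k) x + c) - a| + |c| := abs_sub _ _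
          _ ≤ _ := by gcongr; exact abs_sub _ _
      linarith
    rw [enorm_eq_nnnorm, ENNReal.coe_le_coe, ← NNReal.coe_le_coe, coe_nnnorm, Real.norm_eq_abs]
    exact hm.le.trans hlow

/-! ### The sequence of partial sums of powers of four -/

lemma fourSeq_succ (k : ℕ) : fourSeq (k + 1) = 4 * fourSeq k + 1 := by
  unfold fourSeq
  rw [Finset.sum_range_succ', Finset.mul_sum]
  simp [pow_succ, mul_comm]

lemma three_mul_fourSeq (k : ℕ) : 3 * fourSeq k + 1 = 4 ^ (k + 2) := by
  induction k with
  | zero => simp [fourSeq, Finset.sum_range_succ]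
  | succ k ih => rw [fourSeq_succ, pow_succ, ← ih]; ring

lemma fourSeq_pos (k : ℕ) : 0 < fourSeq k := by
  have := three_mul_fourSeq k
  have h : 0 < 4 ^ k := by positivity
  rw [pow_add] at this
  omega

lemma fourSeq_strictMono : StrictMono fourSeq :=
  strictMono_nat_of_lt_succ fun k => by rw [fourSeq_succ]; omega

lemma testBit_four_mul_add_one (s j : ℕ) :
    (4 * s + 1).testBit (j + 2) = s.testBit j := by
  rw [Nat.testBit_succ, Nat.testBit_succ, show (4 * s + 1) / 2 / 2 = s by omega]

lemma testBit_sum_four_pow (m j : ℕ) :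
    (∑ i ∈ Finset.range m, 4 ^ i).testBit j = true ↔ j % 2 = 0 ∧ j < 2 * m := by
  induction m generalizing j with
  | zero => simp
  | succ m ih =>
    have hs : ∑ i ∈ Finset.range (m + 1), 4 ^ i = 4 * ∑ i ∈ Finset.range m, 4 ^ i + 1 := by
      rw [Finset.sum_range_succ', Finset.mul_sum]
      simp [pow_succ, mul_comm]
    rw [hs]
    match j with
    | 0 => simp [Nat.testBit_zero]; omega
    | 1 =>
      rw [Nat.testBit_succ, Nat.testBit_zero]
      simp only [decide_eq_true_eq]
      omega
    | j + 2 => rw [testBit_four_mul_add_one, ih]; omega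

lemma testBit_fourSeq (k j : ℕ) :
    (fourSeq k).testBit j = true ↔ j % 2 = 0 ∧ j < 2 * (k + 2) :=
  testBit_sum_four_pow _ _

lemma fourSeq_lt_two_pow (k : ℕ) : fourSeq k < 2 ^ (2 * (k + 2)) := by
  have := three_mul_fourSeq k
  rw [pow_mul]
  norm_num
  omega

lemma binVariation_fourSeq (k : ℕ) : binVariation (fourSeq k) = 2 * (k + 2) := by
  rw [binVariation_eq, runEnds_eq (fourSeq_lt_two_pow k)]
  have : runEnds (fourSeq k) 0 (2 * (k + 2)) = (Finset.range (k + 2)).image (2 * ·) := by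
    ext l
    simp only [runEnds, Finset.mem_filter, Finset.mem_Ico, Finset.mem_image, Finset.mem_range,
      testBit_fourSeq, ← Bool.not_eq_true]
    constructor
    · rintro ⟨h1, h2, h3⟩
      exact ⟨l / 2, by omega, by omega⟩
    · rintro ⟨a, ha, rfl⟩
      omega
  rw [this, Finset.card_image_of_injective _ (fun a b h => by simpa using h), Finset.card_range]

lemma log2_fourSeq (k : ℕ) : (fourSeq k).log2 = 2 * (k + 1) := by
  rw [Nat.log2_eq_iff (fourSeq_pos k).ne']
  refine ⟨Nat.ge_two_pow_of_testBit ((testBit_fourSeq k _).2 ⟨by omega, by omega⟩), ?_⟩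
  have := three_mul_fourSeq k
  have h : 0 < 4 ^ k := by positivity
  have e : 2 ^ (2 * (k + 1) + 1) = 8 * 4 ^ k := by
    rw [pow_succ, pow_mul, pow_succ]; ring
  rw [pow_add] at this
  omega

lemma hasNestedSpectra_fourSeq : HasNestedSpectra fourSeq := by
  intro k
  ext j
  rw [Finset.mem_inter, mem_binSpectrum, mem_binSpectrum, sup_binSpectrum (fourSeq_pos k).ne',
    Finset.mem_Iic, log2_fourSeq, testBit_fourSeq, testBit_fourSeq]
  omega

lemma hasUnboundedVariation_fourSeq : HasUnboundedVariation fourSeq := by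
  rintro ⟨M, hM⟩
  have := hM ⟨M, rfl⟩
  simp only [binVariation_fourSeq] at this
  omega

lemma isLacunary_fourSeq : IsLacunary fourSeq := by
  refine ⟨4, by norm_num, fun k => ?_⟩
  have : (0 : ℝ) < fourSeq k := by exact_mod_cast fourSeq_pos k
  rw [le_div_iff₀ this, fourSeq_succ]
  push_cast
  linarith

lemma logb_two_pow (k : ℕ) : Real.logb 2 (2 ^ k) = k := by
  rw [Real.logb_pow, Real.logb_self_eq_one one_lt_two, mul_one]

lemma le_logb_two {k : ℕ} {u : ℝ} (h : 2 ^ k ≤ u) : (k : ℝ) ≤ Real.logb 2 u := by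
  rw [← logb_two_pow k]
  exact Real.logb_le_logb_of_le one_lt_two (by positivity) h

lemma logb_two_le {k : ℕ} {u : ℝ} (hu : 0 < u) (h : u ≤ 2 ^ k) : Real.logb 2 u ≤ k := by
  rw [← logb_two_pow k]
  exact Real.logb_le_logb_of_le one_lt_two hu h

lemma phiSeq_fourSeq_bounds {u : ℝ} (hu : 8 ≤ u) :
    1 / 2 * (u * Real.logb 2 (Real.logb 2 u)) ≤ phiSeq fourSeq u ∧
      phiSeq fourSeq u ≤ 4 * (u * Real.logb 2 (Real.logb 2 u)) := by
  have hu0 : 0 < u := by linarith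
  suffices h : ∃ a b : ℝ, a * u ≤ phiSeq fourSeq u ∧ phiSeq fourSeq u ≤ b * u ∧
      1 / 2 * Real.logb 2 (Real.logb 2 u) ≤ a ∧ b ≤ 4 * Real.logb 2 (Real.logb 2 u) by
    obtain ⟨a, b, h1, h2, h3, h4⟩ := h
    have h5 := mul_le_mul_of_nonneg_right h3 hu0.le
    have h6 := mul_le_mul_of_nonneg_right h4 hu0.le
    constructor <;> linarith
  have h3 : 3 ≤ Real.logb 2 u := by exact_mod_cast le_logb_two (k := 3) (by linarith)
  rcases lt_or_ge u (phiNode fourSeq 0) with h | h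
  · have h5 : fourSeq 0 = 5 := by simp [fourSeq, Finset.sum_range_succ]
    refine ⟨4, 4, ?_, ?_, ?_, ?_⟩
    · rw [phiSeq_of_lt h, binVariation_fourSeq]; norm_num
    · rw [phiSeq_of_lt h, binVariation_fourSeq]; norm_num
    · rw [phiNode, h5] at h
      have h10 : Real.logb 2 u ≤ 10 := by exact_mod_cast logb_two_le (k := 10) hu0 h.le
      have : Real.logb 2 (Real.logb 2 u) ≤ 4 := by
        exact_mod_cast logb_two_le (k := 4) (by linarith) (by linarith)
      linarith
    · have : 1 ≤ Real.logb 2 (Real.logb 2 u) := by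
        exact_mod_cast le_logb_two (k := 1) (by linarith)
      linarith
  · obtain ⟨i, h1, h2⟩ := exists_phiNode_le_lt fourSeq_strictMono h
    have hlow : ((2 * i + 3 : ℕ) : ℝ) ≤ Real.logb 2 (Real.logb 2 u) := by
      refine le_logb_two (le_trans ?_ (le_logb_two h1))
      have e : 2 ^ (2 * i + 3) ≤ 2 * fourSeq i := by
        have := three_mul_fourSeq i
        have h : 0 < 4 ^ i := by positivity
        rw [pow_add] at this ⊢
        rw [pow_mul]
        norm_num at this ⊢
        omega
      exact_mod_cast e
    have hupp : Real.logb 2 (Real.logb 2 u) ≤ ((2 * i + 7 : ℕ) : ℝ) := by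
      refine logb_two_le (by linarith) ((logb_two_le hu0 h2.le).trans ?_)
      have e : 2 * fourSeq (i + 1) ≤ 2 ^ (2 * i + 7) := by
        have := three_mul_fourSeq (i + 1)
        rw [pow_add] at this ⊢
        rw [pow_mul]
        norm_num [pow_succ] at this ⊢
        omega
      exact_mod_cast e
    push_cast at hlow hupp
    refine ⟨2 * (i + 2), 2 * (i + 3), le_phiSeq fourSeq_strictMono h1 h2 ?_ ?_,
      phiSeq_le fourSeq_strictMono h1 h2 ?_ ?_, by linarith, by linarith⟩ <;>
    · rw [binVariation_fourSeq]; push_cast; linarith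

/-! ### Everywhere divergence -/

lemma exists_everywhere_divergent {n : ℕ → ℕ} (hn : StrictMono n) (h0 : ∀ k, 0 < n k)
    (hnest : HasNestedSpectra n) (hV : HasUnboundedVariation n) {φ : ℝ≥0 → ℝ≥0}
    (hφ : IsPhiClass φ)
    (ho : (fun u : ℝ≥0 => (φ u : ℝ)) =o[Filter.atTop] fun u : ℝ≥0 => phiSeq n (u : ℝ)) :
    ∃ f : ℝ → ℝ, MemPhiL φ (Set.Ico 0 1) f ∧ IntegrableOn f (Set.Ico 0 1) ∧
      ∀ x ∈ Set.Ico (0 : ℝ) 1, (⨆ k, ‖walshSum f (n k) x‖ₑ) = ∞ := by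
  obtain ⟨f, h1, h2, h3⟩ := exists_forall_iSup_walshSum_eq_top hφ.1
    fun R η hR hη => exists_isPeak hn h0 hnest hV ho hR hη
  exact ⟨f, h1, h2, fun x _ => h3 x⟩

lemma loglog_isBigO_phiSeq_fourSeq :
    (fun u : ℝ≥0 => (u : ℝ) * Real.logb 2 (Real.logb 2 (u : ℝ))) =O[Filter.atTop]
      fun u : ℝ≥0 => phiSeq fourSeq (u : ℝ) := by
  refine Asymptotics.IsBigO.of_bound 2 ?_
  filter_upwards [Filter.eventually_ge_atTop 8] with u hu
  have hu' : (8 : ℝ) ≤ u := by exact_mod_cast hu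
  obtain ⟨h1, h2⟩ := phiSeq_fourSeq_bounds hu'
  rw [Real.norm_of_nonneg (by linarith)]
  have := Real.le_norm_self (phiSeq fourSeq u)
  linarith

end WalshFourier

theorem theorem2 :
    (∀ n : ℕ → ℕ, StrictMono n → (∀ k, 0 < n k) →
      WalshFourier.HasNestedSpectra n → WalshFourier.HasUnboundedVariation n →
      ∀ φ : ℝ≥0 → ℝ≥0, WalshFourier.IsPhiClass φ →
      (fun u : ℝ≥0 => (φ u : ℝ)) =o[Filter.atTop]
        (fun u : ℝ≥0 => WalshFourier.phiSeq n (u : ℝ)) →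
      ∃ f : ℝ → ℝ, WalshFourier.MemPhiL φ (Set.Ico 0 1) f ∧
        MeasureTheory.IntegrableOn f (Set.Ico 0 1) ∧
        ∀ x ∈ Set.Ico (0 : ℝ) 1, (⨆ k, ‖WalshFourier.walshSum f (n k) x‖ₑ) = ∞) ∧
    (∃ c C : ℝ, 0 < c ∧ 0 < C ∧ ∀ u : ℝ, 8 ≤ u →
      c * (u * Real.logb 2 (Real.logb 2 u)) ≤ WalshFourier.phiSeq WalshFourier.fourSeq u ∧
      WalshFourier.phiSeq WalshFourier.fourSeq u ≤ C * (u * Real.logb 2 (Real.logb 2 u))) ∧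
    WalshFourier.IsLacunary WalshFourier.fourSeq ∧
    (∀ φ : ℝ≥0 → ℝ≥0, WalshFourier.IsPhiClass φ →
      (fun u : ℝ≥0 => (φ u : ℝ)) =o[Filter.atTop]
        (fun u : ℝ≥0 => (u : ℝ) * Real.logb 2 (Real.logb 2 (u : ℝ))) →
      ∃ f : ℝ → ℝ, WalshFourier.MemPhiL φ (Set.Ico 0 1) f ∧
        MeasureTheory.IntegrableOn f (Set.Ico 0 1) ∧
        ∀ x ∈ Set.Ico (0 : ℝ) 1,
          (⨆ k, ‖WalshFourier.walshSum f (WalshFourier.fourSeq k) x‖ₑ) = ∞) := by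
  refine ⟨fun n hn h0 hnest hV φ hφ ho =>
    WalshFourier.exists_everywhere_divergent hn h0 hnest hV hφ ho,
    ⟨1 / 2, 4, by norm_num, by norm_num, fun u hu => WalshFourier.phiSeq_fourSeq_bounds hu⟩,
    WalshFourier.isLacunary_fourSeq, fun φ hφ ho => ?_⟩
  exact WalshFourier.exists_everywhere_divergent WalshFourier.fourSeq_strictMono
    WalshFourier.fourSeq_pos WalshFourier.hasNestedSpectra_fourSeq
    WalshFourier.hasUnboundedVariation_fourSeq hφ
    (ho.trans_isBigO WalshFourier.loglog_isBigO_phiSeq_fourSeq)
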